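/- Let $\mathbb F$ be a field and $\ell\ge 0$ an integer. A persistence module $V_\bullet$ of length $\ell+1$ consists of finite-dimensional $\mathbb F$-vector spaces and linear maps $V_0\xrightarrow{f_1}V_1\to\cdots\xrightarrow{f_\ell}V_\ell$. A bar is an interval $[i,j]$ with $0\le i\le j\le \ell$; its interval module $\mathbf I[i,j]_\bullet$ has $\mathbb F$ at the positions $i,\dots,j$, with identity maps between them, and $0$ elsewhere. Every $V_\bullet$ is isomorphic to a direct sum $\bigoplus_{i\le j}\mathbf I[i,j]_\bullet^{d_{ij}}$ with unique multiplicities $d_{ij}\in\mathbb N$; the bars with $d_{ij}>0$ form its barcode. A bar $[i_2,j_2]$ is strictly nested in $[i_1,j_1]$ if $i_1<i_2\le j_2<j_1$. Write $[i_1,j_1]\preceq[i_2,j_2]$ if $i_1\le i_2\le j_1\le j_2$. A ladder module $(V_\bullet,W_\bullet,\phi_\bullet)$ of length $\ell+1$ is a map $\phi_\bullet:(V_\bullet,f_\bullet)\to (W_\bullet,h_\bullet)$ of persistence modules of length $\ell+1$, i.e. linear maps $\phi_k:V_k\to W_k$ with $\phi_k f_k=h_k\phi_{k-1}$; direct sums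 and isomorphisms are taken pointwise (an isomorphism is given by invertible linear maps on all $V_k$ and $W_k$ that commute with all structure maps and vertical maps). For $[i_1,j_1]\preceq[i_2,j_2]$ let $\mathbf R^{[i_2,j_2]}_{[i_1,j_1]\bullet}$ be the ladder module with source $\mathbf I[i_2,j_2]_\bullet$ and target $\mathbf I[i_1,j_1]_\bullet$ whose vertical map is the identity of $\mathbb F$ at each position in $[i_1,j_1]\cap[i_2,j_2]$ and $0$ elsewhere. Let $\mathbf I^+[i,j]_\bullet$ be the ladder module with source $\mathbf I[i,j]_\bullet$ and target $0$, and $\mathbf I^-[i,j]_\bullet$ the one with source $0$ and target $\mathbf I[i,j]_\bullet$. An ordered barcode basis of $V_\bullet$ consists of a finite list of bars (with repetitions allowed) in lexicographic order together with, for each $k$, a basis of $V_k$ indexed by the bars of the list that contain $k$, such that $f_{k+1}$ sends the basis vector of a bar in $V_k$ to the basis vector of the same bar in $V_{k+1}$ if the bar contains $k+1$, and to $0$ otherwise. **Theorem.** Let $(V_\bullet,W_\bullet,\phi_\bullet)$ be a ladder module of length $\ell+1$ such that neither the barcode of $V_\bullet$ nor the barcode of $W_\bullet$ contains a pair of strictly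 nested bars. Then there are natural numbers $r^{[i_2,j_2]}_{[i_1,j_1]}$ and $d^{\pm}_{ij}$ such that $$(V_\bullet,W_\bullet,\phi_\bullet)\;\simeq\bigoplus_{[i_1,j_1]\preceq[i_2,j_2]}\left(\mathbf R^{[i_2,j_2]}_{[i_1,j_1]\bullet}\right)^{r^{[i_2,j_2]}_{[i_1,j_1]}}\oplus\bigoplus_{i\le j}\left(\mathbf I^+[i,j]_\bullet\right)^{d^+_{ij}}\oplus\bigoplus_{i\le j}\left(\mathbf I^-[i,j]_\bullet\right)^{d^-_{ij}}.$$ Equivalently, $\phi_\bullet$ is a partial matching of bars in suitable barcode bases: there are ordered barcode bases of $V_\bullet$ and $W_\bullet$ and an injective partial map $m$ from the bars of the first list to the bars of the second such that $m(p)\preceq p$ whenever $m(p)$ is defined, and, for every $k$ and every bar $p$ of the first list containing $k$, $\phi_k$ sends the basis vector of $p$ in $V_k$ to the basis vector of $m(p)$ in $W_k$ if $m(p)$ is defined and contains $k$, and to $0$ otherwise. -/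

import Mathlib

universe u v w x y

/-- A bar (interval) `[i, j]` with `0 ≤ i ≤ j ≤ ℓ`. -/
abbrev Bar (ℓ : ℕ) : Type :=
  {p : Fin (ℓ + 1) × Fin (ℓ + 1) // p.1 ≤ p.2}

namespace Bar

variable {ℓ : ℕ}

/-- The left endpoint of a bar. -/
abbrev lo (I : Bar ℓ) : Fin (ℓ + 1) := I.1.1

/-- The right endpoint of a bar. -/
abbrev hi (I : Bar ℓ) : Fin (ℓ + 1) := I.1.2

/-- The index `k` lies in the bar `I`. -/
abbrev Has (I : Bar ℓ) (k : Fin (ℓ + 1)) : Prop := I.lo ≤ k ∧ k ≤ I.hi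

/-- The relation `[a, b] ⪯ [c, d]`, meaning `a ≤ c ≤ b ≤ d`. -/
def Prec (I J : Bar ℓ) : Prop := I.lo ≤ J.lo ∧ J.lo ≤ I.hi ∧ I.hi ≤ J.hi

/-- The lexicographic order on bars. -/
def LexLE (I J : Bar ℓ) : Prop := I.lo < J.lo ∨ (I.lo = J.lo ∧ I.hi ≤ J.hi)

/-- `J` is strictly nested in `I`: `I = [i₁, j₁]`, `J = [i₂, j₂]` and `i₁ < i₂ ≤ j₂ < j₁`. -/
def StrictlyNestedIn (J I : Bar ℓ) : Prop := I.lo < J.lo ∧ J.hi < I.hi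

end Bar

/-- A persistence module of length `ℓ + 1` over the field `F`: finite-dimensional vector spaces
`V₀, …, V_ℓ` and linear maps `V₀ → V₁ → ⋯ → V_ℓ`. -/
structure PersistenceModule (F : Type u) [Field F] (ℓ : ℕ) where
  /-- The vector spaces. -/
  obj : Fin (ℓ + 1) → Type v
  [addCommGroup : ∀ k, AddCommGroup (obj k)]
  [module : ∀ k, Module F (obj k)]
  [finiteDimensional : ∀ k, FiniteDimensional F (obj k)]
  /-- The structure maps. -/
  map : ∀ k : Fin ℓ, obj k.castSucc →ₗ[F] obj k.succ

attribute [instance] PersistenceModule.addCommGroup PersistenceModule.module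
  PersistenceModule.finiteDimensional

namespace PersistenceModule

variable {F : Type u} [Field F] {ℓ : ℕ}

/-- An isomorphism of persistence modules. -/
structure Iso (V : PersistenceModule.{u, v} F ℓ) (W : PersistenceModule.{u, w} F ℓ) where
  /-- The invertible linear maps `V_k → W_k`. -/
  equiv : ∀ k, V.obj k ≃ₗ[F] W.obj k
  comm : ∀ (k : Fin ℓ) (a : V.obj k.castSucc),
    equiv k.succ (V.map k a) = W.map k (equiv k.castSucc a)

/-- The pointwise direct sum of a finite family of persistence modules. -/
abbrev directSum {ι : Type} [Finite ι] (M : ι → PersistenceModule.{u, v} F ℓ) :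
    PersistenceModule.{u, v} F ℓ where
  obj k := ∀ s, (M s).obj k
  map k := LinearMap.pi fun s => (M s).map k ∘ₗ LinearMap.proj s

/-- The zero persistence module. -/
abbrev zero (F : Type u) [Field F] (ℓ : ℕ) : PersistenceModule.{u, u} F ℓ where
  obj _ := PUnit.{u + 1}
  map _ := 0

/-- The `k`-th vector space of the interval module of `I`: the field `F` if `k` lies in `I`, and
`0` otherwise. -/
def intervalSpace (F : Type u) [Field F] (I : Bar ℓ) (k : Fin (ℓ + 1)) : Submodule F F :=
  if I.Has k then ⊤ else ⊥

theorem ite_mem_intervalSpace (J : Bar ℓ) (l : Fin (ℓ + 1)) (a : F) :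
    (if J.Has l then a else 0) ∈ intervalSpace F J l := by
  unfold intervalSpace
  split_ifs <;> simp

/-- The linear map between the spaces at positions `k` and `l` of two interval modules which is the
identity of `F` if both spaces are `F`, and `0` otherwise. -/
def intervalMap (F : Type u) [Field F] (I : Bar ℓ) (k : Fin (ℓ + 1)) (J : Bar ℓ)
    (l : Fin (ℓ + 1)) : intervalSpace F I k →ₗ[F] intervalSpace F J l where
  toFun a := ⟨if J.Has l then (a : F) else 0, ite_mem_intervalSpace J l (a : F)⟩
  map_add' a b := by
    apply Subtype.ext
    by_cases h : J.Has l
    · simp only [if_pos h, Submodule.coe_add]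
    · simp only [if_neg h, Submodule.coe_add, add_zero]
  map_smul' c a := by
    apply Subtype.ext
    by_cases h : J.Has l
    · simp only [if_pos h, Submodule.coe_smul, RingHom.id_apply]
    · simp only [if_neg h, Submodule.coe_smul, RingHom.id_apply, smul_zero]

theorem coe_intervalMap (I : Bar ℓ) (k : Fin (ℓ + 1)) (J : Bar ℓ) (l : Fin (ℓ + 1))
    (a : intervalSpace F I k) :
    (intervalMap F I k J l a : F) = if J.Has l then (a : F) else 0 :=
  rfl

theorem intervalMap_comm (I J : Bar ℓ) (h : I.Prec J) (k : Fin ℓ)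
    (a : intervalSpace F J k.castSucc) :
    intervalMap F J k.succ I k.succ (intervalMap F J k.castSucc J k.succ a) =
      intervalMap F I k.castSucc I k.succ (intervalMap F J k.castSucc I k.castSucc a) := by
  obtain ⟨h₁, h₂, h₃⟩ := h
  have e : k.castSucc < k.succ := Fin.castSucc_lt_succ
  apply Subtype.ext
  simp only [coe_intervalMap]
  by_cases hk : J.Has k.castSucc
  · by_cases hk' : I.Has k.succ
    · have hJ : J.Has k.succ := ⟨hk.1.trans e.le, hk'.2.trans h₃⟩
      have hI : I.Has k.castSucc := ⟨h₁.trans hk.1, e.le.trans hk'.2⟩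
      rw [if_pos hk', if_pos hJ, if_pos hI, if_pos hk']
    · rw [if_neg hk', if_neg hk']
  · have ha : (a : F) = 0 := by
      have h : (a : F) ∈ (if J.Has k.castSucc then (⊤ : Submodule F F) else ⊥) := a.2
      rwa [if_neg hk, Submodule.mem_bot] at h
    simp only [ha, ite_self]

/-- The interval module `I[i, j]`. -/
abbrev interval (F : Type u) [Field F] (I : Bar ℓ) : PersistenceModule.{u, u} F ℓ where
  obj k := intervalSpace F I k
  finiteDimensional k := FiniteDimensional.finiteDimensional_submodule (intervalSpace F I k)
  map k := intervalMap F I k.castSucc I k.succ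

/-- The interval `I` has multiplicity `d I` in the barcode of `V`: the module `V` is isomorphic to
the direct sum of `d I` copies of the interval module of `I`, over all `I`. -/
def HasBarcode (V : PersistenceModule.{u, v} F ℓ) (d : Bar ℓ → ℕ) : Prop :=
  Nonempty (V.Iso (directSum fun s : Σ I : Bar ℓ, Fin (d I) => interval F s.1))

/-- The barcode of `V` contains no pair of strictly nested bars. (Every `V` has a barcode, and only
one, by the interval decomposition theorem.) -/
def NoStrictlyNestedBars (V : PersistenceModule.{u, v} F ℓ) : Prop :=
  ∀ d : Bar ℓ → ℕ, V.HasBarcode d → ∀ I J : Bar ℓ, 0 < d I → 0 < d J → ¬ J.StrictlyNestedIn I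

/-- An ordered barcode basis of `V`: a list of bars in lexicographic order, and for every `k` a
basis of `V_k` indexed (in this order) by the bars that contain `k`, such that the structure maps
send the `k`-th basis vector of a bar to its `(k+1)`-st one, or to `0` if the bar ends at `k`. -/
structure BarcodeBasis (V : PersistenceModule.{u, v} F ℓ) where
  /-- The number of bars. -/
  card : ℕ
  /-- The list of bars. -/
  bar : Fin card → Bar ℓ
  lexLE : ∀ p q, p ≤ q → (bar p).LexLE (bar q)
  /-- The bases. -/
  basis : ∀ k, Module.Basis {p : Fin card // (bar p).Has k} F (V.obj k)
  map_basis : ∀ (k : Fin ℓ) (p : {p : Fin card // (bar p).Has k.castSucc}),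
    V.map k (basis k.castSucc p) =
      if h : (bar p).Has k.succ then basis k.succ ⟨p, h⟩ else 0

end PersistenceModule

/-- A ladder persistence module `(V, W, φ)` of length `ℓ + 1`: a map `φ : V → W` of persistence
modules. -/
structure LadderModule (F : Type u) [Field F] (ℓ : ℕ) where
  /-- The source `V`. -/
  src : PersistenceModule.{u, v} F ℓ
  /-- The target `W`. -/
  tgt : PersistenceModule.{u, w} F ℓ
  /-- The map `φ`. -/
  hom : ∀ k, src.obj k →ₗ[F] tgt.obj k
  comm : ∀ (k : Fin ℓ) (a : src.obj k.castSucc),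
    hom k.succ (src.map k a) = tgt.map k (hom k.castSucc a)

namespace LadderModule

open PersistenceModule

variable {F : Type u} [Field F] {ℓ : ℕ}

/-- An isomorphism of ladder persistence modules. -/
structure Iso (L : LadderModule.{u, v, w} F ℓ) (M : LadderModule.{u, x, y} F ℓ) where
  /-- The isomorphism of the sources. -/
  src : L.src.Iso M.src
  /-- The isomorphism of the targets. -/
  tgt : L.tgt.Iso M.tgt
  comm : ∀ k (a : L.src.obj k), tgt.equiv k (L.hom k a) = M.hom k (src.equiv k a)

/-- The pointwise direct sum of a finite family of ladder persistence modules. -/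
abbrev directSum {ι : Type} [Finite ι] (M : ι → LadderModule.{u, v, w} F ℓ) :
    LadderModule.{u, v, w} F ℓ where
  src := PersistenceModule.directSum fun s => (M s).src
  tgt := PersistenceModule.directSum fun s => (M s).tgt
  hom k := LinearMap.pi fun s => (M s).hom k ∘ₗ LinearMap.proj s
  comm k a := funext fun s => (M s).comm k (a s)

/-- The ladder module `R` with source the interval module of `J = [i₂, j₂]` and target the interval
module of `I = [i₁, j₁]`, where `I ⪯ J`; the vertical maps are `1` wherever possible and `0`
otherwise. -/
abbrev R (F : Type u) [Field F] (I J : Bar ℓ) (h : I.Prec J) : LadderModule.{u, u, u} F ℓ where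
  src := interval F J
  tgt := interval F I
  hom k := intervalMap F J k I k
  comm k a := intervalMap_comm I J h k a

/-- The ladder module `I⁺[i, j]`, with source the interval module of `I` and target `0`. -/
abbrev IPlus (F : Type u) [Field F] (I : Bar ℓ) : LadderModule.{u, u, u} F ℓ where
  src := interval F I
  tgt := zero F ℓ
  hom _ := 0
  comm _ _ := rfl

/-- The ladder module `I⁻[i, j]`, with source `0` and target the interval module of `I`. -/
abbrev IMinus (F : Type u) [Field F] (I : Bar ℓ) : LadderModule.{u, u, u} F ℓ where
  src := zero F ℓ
  tgt := interval F I
  hom _ := 0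
  comm _ _ := by simp only [LinearMap.zero_apply, map_zero]

/-- The pairs of bars `(I, J)` with `I ⪯ J`. -/
abbrev PrecPair (ℓ : ℕ) : Type := {p : Bar ℓ × Bar ℓ // p.1.Prec p.2}

/-- The direct sum, over all pairs `[i₁, j₁] ⪯ [i₂, j₂]`, of `r` copies of `R`, and, over all
`[i, j]`, of `dp` copies of `I⁺[i, j]` and `dm` copies of `I⁻[i, j]`. -/
def standardSum (F : Type u) [Field F] (r : PrecPair ℓ → ℕ) (dp dm : Bar ℓ → ℕ) :
    LadderModule.{u, u, u} F ℓ :=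
  directSum (ι := (Σ p : PrecPair ℓ, Fin (r p)) ⊕ (Σ I : Bar ℓ, Fin (dp I)) ⊕
      (Σ I : Bar ℓ, Fin (dm I))) <|
    Sum.elim (fun s => R F s.1.1.1 s.1.1.2 s.1.2) <|
      Sum.elim (fun s => IPlus F s.1) (fun s => IMinus F s.1)

/-- In the barcode bases `B` of the source and `C` of the target, the map `φ` is given by the
partial matching `m` of the bars of `B` with the bars of `C`: if the bar `p` is matched with the
bar `q`, then `q ⪯ p` and every `φ_k` sends the basis vector of `p` to that of `q` where both
exist and to `0` otherwise; the basis vectors of the unmatched bars of `B` are sent to `0`. -/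
structure IsMatchedBy (L : LadderModule.{u, v, w} F ℓ) (B : L.src.BarcodeBasis)
    (C : L.tgt.BarcodeBasis) (m : Fin B.card ≃. Fin C.card) : Prop where
  prec : ∀ p q, m p = some q → (C.bar q).Prec (B.bar p)
  matched : ∀ k (p : {p : Fin B.card // (B.bar p).Has k}) (q : Fin C.card), m p = some q →
    L.hom k (B.basis k p) = if h : (C.bar q).Has k then C.basis k ⟨q, h⟩ else 0
  unmatched : ∀ k (p : {p : Fin B.card // (B.bar p).Has k}), m p = none →
    L.hom k (B.basis k p) = 0

end LadderModule

/-! ### Families of vectors supported on part of an index type -/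

section FiniteFamilies

variable {F : Type*} [Field F] {M : Type*} [AddCommGroup M] [Module F M] {ι : Type*} [Fintype ι]

/-! A nonzero map from the interval module of `p` to that of `q` forces `q ⪯ p` and is a scalar, so
in barcode bases φ is a matrix of scalars. When no bars are strictly nested, the lexicographic order
makes both endpoints monotone. Then a combination of the generators of `p` and of earlier bars, cut
off outside `p`, again generates an interval with bar `p`: all earlier bars have begun when `p`
begins, and none outlives `p`. So every lower triangular matrix with nonzero diagonal is an
admissible change of barcode basis, in the source and in the target (`IsBarcodeFamily.triangular`).

Such changes suffice to turn any matrix into a partial matching (`exists_triangular_elimination`, a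
form of the Bruhat decomposition). Matched bars that do not meet give the zero map and are released
(`exists_matching`). A matched pair then spans a copy of `R`, an unmatched source bar an `IPlus`, an
unmatched target bar an `IMinus` (`nonempty_iso_directSum_of_matching`).

Barcode bases exist by `exists_isBarcodeFamily`: split off an interval that begins at the first
nonzero space, and induct on the total dimension. -/

theorem sum_subtype_smul (x : ι → M) (P : ι → Prop) [DecidablePred P] (c : ι → F)
    (hc : ∀ s, ¬ P s → c s • x s = 0) :
    ∑ s : {s // P s}, c s • x s = ∑ s, c s • x s := by
  rw [← Fintype.sum_subtype_add_sum_subtype P fun s => c s • x s, left_eq_add]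
  exact Finset.sum_eq_zero fun s _ => hc s s.2

/-- Coefficients live on all of `ι`, so one index type serves at every position `k` while `P` varies
with `k`. -/
theorem linearIndependent_subtype_iff_forall (x : ι → M) (P : ι → Prop) [DecidablePred P] :
    (LinearIndependent F fun s : {s // P s} => x s) ↔
      ∀ c : ι → F, (∀ s, ¬ P s → c s = 0) → ∑ s, c s • x s = 0 → ∀ s, c s = 0 := by
  rw [Fintype.linearIndependent_iff]
  constructor
  · intro h c hc h0 s
    by_cases hs : P s
    · refine h (fun s => c s) ?_ ⟨s, hs⟩
      rw [sum_subtype_smul x P c fun s hs => by rw [hc s hs, zero_smul], h0]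
    · exact hc s hs
  · intro h g hg s
    have key := h (fun s => if hs : P s then g ⟨s, hs⟩ else 0) (fun s hs => dif_neg hs) ?_ s
    · simpa [s.2] using key
    · rw [← sum_subtype_smul x P _ fun s hs => by rw [dif_neg hs, zero_smul], ← hg]
      exact Finset.sum_congr rfl fun s _ => by rw [dif_pos s.2]

theorem span_subtype_eq_top_iff (x : ι → M) (P : ι → Prop) [DecidablePred P]
    (hx : ∀ s, ¬ P s → x s = 0) :
    Submodule.span F (Set.range fun s : {s // P s} => x s) = ⊤ ↔
      ∀ a, ∃ c : ι → F, ∑ s, c s • x s = a := by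
  rw [← top_le_iff, Submodule.top_le_span_range_iff_forall_exists_fun]
  refine forall_congr' fun a => ?_
  constructor
  · rintro ⟨g, hg⟩
    refine ⟨fun s => if hs : P s then g ⟨s, hs⟩ else 0, ?_⟩
    rw [← sum_subtype_smul x P _ fun s hs => by rw [dif_neg hs, zero_smul], ← hg]
    exact Finset.sum_congr rfl fun s _ => by rw [dif_pos s.2]
  · rintro ⟨c, hc⟩
    exact ⟨fun s => c s, by rw [sum_subtype_smul x P c fun s hs => by rw [hx s hs, smul_zero], hc]⟩

end FiniteFamilies

/-! ### The interval decomposition -/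

namespace PersistenceModule

variable {F : Type u} [Field F] {ℓ : ℕ}

/-- The vectors `x s k ∈ V_k` generate interval submodules, with bars `bar s`, whose direct sum
is `V`. -/
structure IsBarcodeFamily (V : PersistenceModule.{u, v} F ℓ) {ι : Type} (bar : ι → Bar ℓ)
    (x : ι → ∀ k, V.obj k) : Prop where
  eq_zero : ∀ s k, ¬ (bar s).Has k → x s k = 0
  map_of_has : ∀ s k, (bar s).Has k.castSucc → V.map k (x s k.castSucc) = x s k.succ
  linearIndependent : ∀ k, LinearIndependent F fun s : {s // (bar s).Has k} => x s k
  span_eq_top : ∀ k, Submodule.span F (Set.range fun s : {s // (bar s).Has k} => x s k) = ⊤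

theorem exists_extension (V : PersistenceModule.{u, v} F ℓ) (i : Fin (ℓ + 1)) (a : V.obj i) :
    ∃ ξ : ∀ k, V.obj k, ξ i = a ∧
      ∀ k : Fin ℓ, i ≤ k.castSucc → V.map k (ξ k.castSucc) = ξ k.succ := by
  classical
  refine ⟨fun k => Fin.induction (motive := V.obj) (if h : i = 0 then h ▸ a else 0)
    (fun k b => if h : i = k.succ then h ▸ a else V.map k b) k, ?_, fun k hk => ?_⟩
  · cases i using Fin.cases with
    | zero => simp
    | succ k => simp
  · have : i ≠ k.succ := (hk.trans_lt Fin.castSucc_lt_succ).ne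
    simp [this]

/-- Dual to `exists_extension`: `f` is pulled back from `j`, and the values beyond `j` play no role.
-/
theorem exists_coextension (V : PersistenceModule.{u, v} F ℓ) (j : Fin (ℓ + 1))
    (f : V.obj j →ₗ[F] F) :
    ∃ μ : ∀ k, V.obj k →ₗ[F] F, μ j = f ∧
      ∀ k : Fin ℓ, k.succ ≤ j → ∀ a, μ k.succ (V.map k a) = μ k.castSucc a := by
  classical
  refine ⟨fun k => Fin.reverseInduction (motive := fun k => V.obj k →ₗ[F] F)
    (if h : j = Fin.last ℓ then h ▸ f else 0)
    (fun k g => if h : j = k.castSucc then h ▸ f else g ∘ₗ V.map k) k, ?_, fun k hk a => ?_⟩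
  · cases j using Fin.lastCases with
    | last => simp
    | cast k => simp
  · have : j ≠ k.castSucc := (Fin.castSucc_lt_succ.trans_le hk).ne'
    simp [this]

/-- The kernel of a family of functionals. -/
abbrev ker (V : PersistenceModule.{u, v} F ℓ) (μ : ∀ k, V.obj k →ₗ[F] F)
    (h : ∀ k a, μ k.castSucc a = 0 → μ k.succ (V.map k a) = 0) : PersistenceModule.{u, v} F ℓ where
  obj k := LinearMap.ker (μ k)
  map k := (V.map k).restrict fun a ha => h k a ha

/-- On `I`, the splitting a = μ(a)ξ + (a − μ(a)ξ) makes `V` the sum of the line of `ξ` and the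
kernel of `μ`. Off `I`, both `ξ` and `μ` vanish and the kernel is everything. -/
theorem IsBarcodeFamily.option {V : PersistenceModule.{u, v} F ℓ} {μ : ∀ k, V.obj k →ₗ[F] F}
    {h : ∀ k a, μ k.castSucc a = 0 → μ k.succ (V.map k a) = 0} {ι : Type} [Fintype ι]
    {bar : ι → Bar ℓ} {x : ι → ∀ k, (V.ker μ h).obj k} (hx : (V.ker μ h).IsBarcodeFamily bar x)
    {I : Bar ℓ} {ξ : ∀ k, V.obj k} (hξ : ∀ k, ¬ I.Has k → ξ k = 0)
    (hξm : ∀ k, I.Has k.castSucc → V.map k (ξ k.castSucc) = ξ k.succ)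
    (hμ : ∀ k, ¬ I.Has k → μ k = 0) (hμξ : ∀ k, I.Has k → μ k (ξ k) = 1) :
    V.IsBarcodeFamily (fun o : Option ι => o.elim I bar)
      (fun o k => o.elim (ξ k) fun s => (x s k : V.obj k)) := by
  have h0 : ∀ s k, ¬ ((Option.elim s I bar).Has k) →
      (Option.elim s (ξ k) fun s => (x s k : V.obj k)) = 0 := by
    rintro (_ | s) k hk
    · exact hξ k hk
    · exact congrArg Subtype.val (hx.eq_zero s k hk)
  refine ⟨h0, ?_, fun k => ?_, fun k => ?_⟩
  · rintro (_ | s) k hk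
    · exact hξm k hk
    · exact congrArg Subtype.val (hx.map_of_has s k hk)
  · rw [linearIndependent_subtype_iff_forall (fun o : Option ι => o.elim (ξ k) fun s => (x s k : V.obj k))
      fun o : Option ι => (o.elim I bar).Has k]
    intro c hc hsum
    simp only [Fintype.sum_option, Option.elim_none, Option.elim_some] at hsum
    have hn : c none = 0 := by
      by_cases hk : I.Has k
      · have := congrArg (μ k) hsum
        simpa [hμξ k hk] using this
      · exact hc none hk
    rw [hn, zero_smul, zero_add] at hsum
    have key := (linearIndependent_subtype_iff_forall (fun s => x s k) _).1 (hx.linearIndependent k)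
      (fun s => c (some s)) (fun s hs => hc (some s) hs) (by
        apply Subtype.ext
        simpa using hsum)
    rintro (_ | s)
    · exact hn
    · exact key s
  · rw [span_subtype_eq_top_iff (fun o : Option ι => o.elim (ξ k) fun s => (x s k : V.obj k))
      (fun o : Option ι => (o.elim I bar).Has k) fun s hs => h0 s k hs]
    intro a
    have ha : a - μ k a • ξ k ∈ LinearMap.ker (μ k) := by
      by_cases hk : I.Has k
      · simp [hμξ k hk]
      · simp [hμ k hk]
    obtain ⟨c, hc⟩ := (span_subtype_eq_top_iff (fun s => x s k) _
      fun s hs => hx.eq_zero s k hs).1 (hx.span_eq_top k) ⟨_, ha⟩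
    refine ⟨fun o => o.elim (μ k a) c, ?_⟩
    have hc' := congrArg Subtype.val hc
    simp only [Submodule.coe_sum, Submodule.coe_smul] at hc'
    simp only [Fintype.sum_option, Option.elim_none, Option.elim_some]
    rw [hc', add_sub_cancel]

/-- A nonzero persistence module has an interval summand. -/
theorem exists_interval_summand (V : PersistenceModule.{u, v} F ℓ) (hV : ∃ k, Nontrivial (V.obj k)) :
    ∃ (I : Bar ℓ) (ξ : ∀ k, V.obj k) (μ : ∀ k, V.obj k →ₗ[F] F), (∀ k, ¬ I.Has k → ξ k = 0) ∧
      (∀ k, I.Has k.castSucc → V.map k (ξ k.castSucc) = ξ k.succ) ∧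
      (∀ k, ¬ I.Has k → μ k = 0) ∧ (∀ k, I.Has k → μ k (ξ k) = 1) ∧
      ∀ k a, μ k.castSucc a = 0 → μ k.succ (V.map k a) = 0 := by
  classical
  -- Minimality of `i` makes the kernel of the functional stable under the map into position `i`,
  -- whose domain is zero.
  obtain ⟨i, hi, hmin⟩ : ∃ i, Nontrivial (V.obj i) ∧ ∀ k < i, Subsingleton (V.obj k) := by
    have hwf := (inferInstance : WellFoundedLT (Fin (ℓ + 1))).wf
    refine ⟨hwf.min {k | Nontrivial (V.obj k)} hV, hwf.min_mem _ hV, fun k hk => ?_⟩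
    rw [← not_nontrivial_iff_subsingleton]
    exact fun hk' => hwf.not_lt_min {k | Nontrivial (V.obj k)} hk' hk
  obtain ⟨a, ha⟩ := exists_ne (0 : V.obj i)
  obtain ⟨ξ, hξi, hξ⟩ := V.exists_extension i a
  let S : Finset (Fin (ℓ + 1)) := Finset.univ.filter fun k => ξ k ≠ 0
  have hiS : i ∈ S := by simp [S, hξi, ha]
  let j := S.max' ⟨i, hiS⟩
  have hij : i ≤ j := S.le_max' i hiS
  have hj : ξ j ≠ 0 := (Finset.mem_filter.1 (S.max'_mem ⟨i, hiS⟩)).2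
  have hjmax : ∀ k, j < k → ξ k = 0 := fun k hk => by
    by_contra h
    exact absurd (S.le_max' k (by simp [S, h])) (not_le.2 hk)
  obtain ⟨f, hf⟩ := Module.Projective.exists_dual_ne_zero F hj
  -- Normalised to 1 on `ξ j`, the functional stays 1 on `ξ` when pulled back as far as `i`.
  obtain ⟨μ, hμj, hμ⟩ := V.exists_coextension j ((f (ξ j))⁻¹ • f)
  have hone : ∀ n : ℕ, ∀ k : Fin (ℓ + 1), (k : ℕ) + n = j → i ≤ k → μ k (ξ k) = 1 := by
    intro n
    induction n with
    | zero =>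
      intro k hk _
      obtain rfl : k = j := Fin.ext hk
      rw [hμj, LinearMap.smul_apply, smul_eq_mul, inv_mul_cancel₀ hf]
    | succ n ih =>
      intro k hk hik
      cases k using Fin.lastCases with
      | last => have := j.2; simp at hk; omega
      | cast k =>
        rw [← hμ k (by rw [Fin.le_def, Fin.val_succ]; simp at hk; omega), hξ k hik]
        refine ih _ ?_ (hik.trans Fin.castSucc_lt_succ.le)
        simp at hk ⊢; omega
  refine ⟨⟨(i, j), hij⟩, ξ, fun k => if i ≤ k ∧ k ≤ j then μ k else 0, ?_, ?_, ?_, ?_, ?_⟩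
  · intro k hk
    by_cases hik : i ≤ k
    · exact hjmax k (not_le.1 fun h => hk ⟨hik, h⟩)
    · have := hmin k (not_le.1 hik)
      exact Subsingleton.elim _ _
  · exact fun k hk => hξ k hk.1
  · exact fun k hk => if_neg hk
  · intro k hk
    have : i ≤ k ∧ k ≤ j := hk
    simp only [if_pos this]
    exact hone (j - k) k (by have := Fin.le_def.1 this.2; omega) this.1
  · intro k b hb
    beta_reduce at hb
    by_cases hk : i ≤ k.succ ∧ k.succ ≤ j
    · simp only [if_pos hk]
      by_cases hik : i ≤ k.castSucc
      · rw [if_pos ⟨hik, Fin.castSucc_lt_succ.le.trans hk.2⟩] at hb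
        rw [hμ k hk.2, hb]
      · have := hmin _ (not_le.1 hik)
        rw [Subsingleton.elim b 0, map_zero, map_zero]
    · simp only [if_neg hk, LinearMap.zero_apply]

/-- The interval decomposition theorem. -/
theorem exists_isBarcodeFamily (V : PersistenceModule.{u, v} F ℓ) :
    ∃ (ι : Type) (_ : Fintype ι) (bar : ι → Bar ℓ) (x : ι → ∀ k, V.obj k),
      V.IsBarcodeFamily bar x := by
  induction hn : ∑ k, Module.finrank F (V.obj k) using Nat.strong_induction_on generalizing V with
  | _ n ih =>
  by_cases hV : ∃ k, Nontrivial (V.obj k)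
  · obtain ⟨I, ξ, μ, h1, h2, h3, h4, h5⟩ := V.exists_interval_summand hV
    obtain ⟨ι, _, bar, x, hx⟩ := ih _ (by
      rw [← hn]
      -- The dimension drops at the left end of `I`, where the functional is nonzero.
      refine Finset.sum_lt_sum (fun k _ => Submodule.finrank_le (LinearMap.ker (μ k)))
        ⟨I.lo, Finset.mem_univ _, Submodule.finrank_lt ?_⟩
      intro h
      have h' := h4 I.lo ⟨le_rfl, I.2⟩
      rw [LinearMap.ker_eq_top.1 h] at h'
      simp at h') (V.ker μ h5) rfl
    exact ⟨Option ι, inferInstance, _, _, hx.option h1 h2 h3 h4⟩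
  · have hV' : ∀ k, Subsingleton (V.obj k) := fun k =>
      not_nontrivial_iff_subsingleton.1 fun h => hV ⟨k, h⟩
    refine ⟨Empty, inferInstance, Empty.elim, fun s => s.elim, fun s => s.elim, fun s => s.elim,
      fun k => linearIndependent_empty_type, fun k => Subsingleton.elim _ _⟩

end PersistenceModule

/-! ### Coordinates on direct sums, and triangular changes of basis -/

section FiniteFamilies

variable {F : Type*} [Field F] {M : Type*} [AddCommGroup M] [Module F M]

/-- The value `none` of `σ` marks zero summands, such as the source of `IMinus`; all other summands
correspond bijectively to `κ`. -/
theorem bijective_sum_smul {ι κ : Type*} [Fintype ι] [Fintype κ] {N : ι → Type*}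
    [∀ s, AddCommGroup (N s)] [∀ s, Module F (N s)] (χ : ∀ s, N s →ₗ[F] F) (σ : ι → Option κ)
    (hσ : ∀ t, ∃! s, σ s = some t) (x : κ → M) (P : κ → Prop) [DecidablePred P]
    (hx : ∀ t, ¬ P t → x t = 0) (hli : LinearIndependent F fun t : {t // P t} => x t)
    (hspan : Submodule.span F (Set.range fun t : {t // P t} => x t) = ⊤)
    (hinj : ∀ s, Function.Injective (χ s))
    (hpos : ∀ s t, σ s = some t → P t → Function.Surjective (χ s))
    (hneg : ∀ s t, σ s = some t → ¬ P t → Subsingleton (N s))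
    (hnone : ∀ s, σ s = none → Subsingleton (N s)) :
    Function.Bijective
      (∑ s, ((χ s).smulRight ((σ s).elim 0 x)) ∘ₗ LinearMap.proj s : (∀ s, N s) →ₗ[F] M) := by
  choose j hj hj' using hσ
  have hjinj : Function.Injective j := fun t t' h => by
    have := hj t
    rw [h, hj t'] at this
    exact (Option.some_injective _ this).symm
  have hout : ∀ s, s ∉ Set.range j → σ s = none := fun s hs => by
    cases h : σ s with
    | none => rfl
    | some t => exact absurd ⟨t, (hj' t s h).symm⟩ hs
  have hsum : ∀ a : ∀ s, N s,
      (∑ s, ((χ s).smulRight ((σ s).elim 0 x)) ∘ₗ LinearMap.proj s : (∀ s, N s) →ₗ[F] M) a =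
        ∑ t, χ (j t) (a (j t)) • x t := fun a => by
    rw [LinearMap.sum_apply]
    symm
    refine Fintype.sum_of_injective j hjinj _ _ (fun s hs => ?_) fun t => ?_
    · simp [hout s hs]
    · simp [hj t]
  constructor
  · rw [injective_iff_map_eq_zero]
    intro a ha
    rw [hsum] at ha
    have key := (linearIndependent_subtype_iff_forall x P).1 hli (fun t => χ (j t) (a (j t)))
      (fun t ht => by
        have := hneg _ t (hj t) ht
        rw [Subsingleton.elim (a (j t)) 0, map_zero]) ha
    funext s
    by_cases hs : s ∈ Set.range j
    · obtain ⟨t, rfl⟩ := hs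
      exact hinj _ (by rw [key t, Pi.zero_apply, map_zero])
    · have := hnone s (hout s hs)
      exact Subsingleton.elim _ _
  · intro b
    obtain ⟨c, hc⟩ := (span_subtype_eq_top_iff x P hx).1 hspan b
    have hex : ∀ s, ∃ a : N s, ∀ t, j t = s → P t → χ s a = c t := by
      intro s
      by_cases hs : ∃ t, j t = s ∧ P t
      · obtain ⟨t, rfl, ht⟩ := hs
        obtain ⟨a, ha⟩ := hpos _ t (hj t) ht (c t)
        exact ⟨a, fun t' h _ => by rw [hjinj h, ha]⟩
      · exact ⟨0, fun t h ht => absurd ⟨t, h, ht⟩ hs⟩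
    choose a ha using hex
    refine ⟨a, ?_⟩
    rw [hsum, ← hc]
    refine Finset.sum_congr rfl fun t _ => ?_
    by_cases ht : P t
    · rw [ha _ t rfl ht]
    · rw [hx t ht, smul_zero, smul_zero]

/-- A lower triangular combination of the vectors of a basis. -/
theorem linearIndependent_and_span_of_triangular {κ : Type*} [Fintype κ] [LinearOrder κ]
    (b : Module.Basis κ F M) (A : κ → κ → F) (hA : ∀ p, A p p ≠ 0)
    (hA' : ∀ p q, p < q → A p q = 0) :
    (LinearIndependent F fun p => ∑ q, A p q • b q) ∧
      Submodule.span F (Set.range fun p => ∑ q, A p q • b q) = ⊤ := by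
  rw [Module.Basis.is_basis_iff_det b, Module.Basis.det_apply]
  -- `toMatrix` writes the vectors as columns, so the matrix becomes upper triangular; its
  -- determinant is the product of the diagonal.
  have h : b.toMatrix (fun p => ∑ q, A p q • b q) = Matrix.of fun i j => A j i := by
    ext i j
    rw [Module.Basis.toMatrix_apply, Module.Basis.repr_sum_self]
    rfl
  rw [h, Matrix.det_of_isUpperTriangular]
  · exact (Finset.prod_ne_zero_iff.2 fun p _ => hA p).isUnit
  · exact fun i j hij => hA' j i hij

end FiniteFamilies

namespace Bar

variable {ℓ : ℕ}

theorem exists_sort {ι : Type*} [Fintype ι] (bar : ι → Bar ℓ) :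
    ∃ e : Fin (Fintype.card ι) ≃ ι, ∀ p q, p ≤ q → (bar (e p)).LexLE (bar (e q)) := by
  let e := (Fintype.equivFin ι).symm
  let f : Fin (Fintype.card ι) → Fin (ℓ + 1) ×ₗ Fin (ℓ + 1) := fun p => toLex (bar (e p)).1
  refine ⟨(Tuple.sort f).trans e, fun p q h => ?_⟩
  exact (Prod.Lex.le_iff).1 (Tuple.monotone_sort f h)

end Bar

/-! ### Barcode families: isomorphisms and triangular changes -/

namespace PersistenceModule

variable {F : Type u} [Field F] {ℓ : ℕ} {V : PersistenceModule.{u, v} F ℓ}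

theorem intervalSpace_eq_top {I : Bar ℓ} {k : Fin (ℓ + 1)} (h : I.Has k) :
    intervalSpace F I k = ⊤ := if_pos h

theorem surjective_subtype_intervalSpace {I : Bar ℓ} {k : Fin (ℓ + 1)} (h : I.Has k) :
    Function.Surjective (intervalSpace F I k).subtype := fun a =>
  ⟨⟨a, by rw [intervalSpace_eq_top h]; trivial⟩, rfl⟩

theorem subsingleton_intervalSpace {I : Bar ℓ} {k : Fin (ℓ + 1)} (h : ¬ I.Has k) :
    Subsingleton (intervalSpace F I k) := by
  rw [show intervalSpace F I k = ⊥ from if_neg h]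
  infer_instance

namespace IsBarcodeFamily

/-- Past the right end both sides vanish, so combinations can be pushed forward even after some of
their bars have ended. -/
theorem map_of_le {ι : Type} {bar : ι → Bar ℓ} {x : ι → ∀ k, V.obj k}
    (hx : V.IsBarcodeFamily bar x) (s : ι) (k : Fin ℓ) (h : (bar s).lo ≤ k.castSucc) :
    V.map k (x s k.castSucc) = x s k.succ := by
  by_cases hk : k.castSucc ≤ (bar s).hi
  · exact hx.map_of_has s k ⟨h, hk⟩
  · rw [hx.eq_zero s _ fun h' => hk h'.2,
      hx.eq_zero s _ fun h' => hk (Fin.castSucc_lt_succ.le.trans h'.2), map_zero]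

theorem comp_equiv {ι κ : Type} {bar : ι → Bar ℓ} {x : ι → ∀ k, V.obj k}
    (hx : V.IsBarcodeFamily bar x) (e : κ ≃ ι) :
    V.IsBarcodeFamily (fun t => bar (e t)) fun t => x (e t) where
  eq_zero t := hx.eq_zero (e t)
  map_of_has t := hx.map_of_has (e t)
  linearIndependent k := (hx.linearIndependent k).comp
    (fun t : {t // (bar (e t)).Has k} => ⟨e t, t.2⟩)
    fun t t' h => Subtype.ext (e.injective (congrArg Subtype.val h))
  span_eq_top k := by
    rw [← hx.span_eq_top k]
    congr 1
    ext a
    constructor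
    · rintro ⟨t, rfl⟩
      exact ⟨⟨e t, t.2⟩, rfl⟩
    · rintro ⟨s, rfl⟩
      exact ⟨⟨e.symm s, by simpa using s.2⟩, by simp⟩

/-- The bases of a barcode family. -/
noncomputable def basis {ι : Type} {bar : ι → Bar ℓ} {x : ι → ∀ k, V.obj k}
    (hx : V.IsBarcodeFamily bar x) (k : Fin (ℓ + 1)) :
    Module.Basis {s // (bar s).Has k} F (V.obj k) :=
  Module.Basis.mk (hx.linearIndependent k) (hx.span_eq_top k).ge

theorem basis_apply {ι : Type} {bar : ι → Bar ℓ} {x : ι → ∀ k, V.obj k}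
    (hx : V.IsBarcodeFamily bar x) (k : Fin (ℓ + 1)) (s : {s // (bar s).Has k}) :
    hx.basis k s = x s k := Module.Basis.mk_apply _ _ _

/-- The barcode basis of a lexicographically ordered barcode family. -/
noncomputable def barcodeBasis {n : ℕ} {bar : Fin n → Bar ℓ} {x : Fin n → ∀ k, V.obj k}
    (hx : V.IsBarcodeFamily bar x) (hbar : ∀ p q, p ≤ q → (bar p).LexLE (bar q)) :
    V.BarcodeBasis where
  card := n
  bar := bar
  lexLE := hbar
  basis := hx.basis
  map_basis k p := by
    rw [basis_apply, hx.map_of_has p k p.2]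
    split_ifs with h
    · rw [basis_apply]
    · exact hx.eq_zero p _ h

/-- The inverse is given explicitly so that compatibility with φ can later be checked summand by
summand. -/
theorem exists_iso {ι κ : Type} [Fintype ι] [Fintype κ] {bar : κ → Bar ℓ} {x : κ → ∀ k, V.obj k}
    (hx : V.IsBarcodeFamily bar x) (N : ι → PersistenceModule.{u, w} F ℓ) (σ : ι → Option κ)
    (hσ : ∀ t, ∃! s, σ s = some t) (χ : ∀ s k, (N s).obj k →ₗ[F] F)
    (hinj : ∀ s k, Function.Injective (χ s k))
    (hpos : ∀ s t k, σ s = some t → (bar t).Has k → Function.Surjective (χ s k))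
    (hneg : ∀ s t k, σ s = some t → ¬ (bar t).Has k → Subsingleton ((N s).obj k))
    (hnone : ∀ s k, σ s = none → Subsingleton ((N s).obj k))
    (hmap : ∀ s t k a, σ s = some t → (bar t).Has k.castSucc → (bar t).Has k.succ →
      χ s k.succ ((N s).map k a) = χ s k.castSucc a) :
    ∃ e : V.Iso (directSum N), ∀ k a,
      (e.equiv k).symm a = ∑ s, χ s k (a s) • (σ s).elim 0 fun t => x t k := by
  let ψ : ∀ k, (∀ s, (N s).obj k) →ₗ[F] V.obj k := fun k =>
    ∑ s, (χ s k).smulRight ((σ s).elim 0 fun t => x t k) ∘ₗ LinearMap.proj s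
  have hψ : ∀ k a, ψ k a = ∑ s, χ s k (a s) • (σ s).elim 0 fun t => x t k := fun k a => by
    simp [ψ]
  have hb : ∀ k, Function.Bijective (ψ k) := fun k =>
    bijective_sum_smul (fun s => χ s k) σ hσ (fun t => x t k) (fun t => (bar t).Has k)
      (fun t h => hx.eq_zero t k h) (hx.linearIndependent k) (hx.span_eq_top k)
      (fun s => hinj s k) (fun s t => hpos s t k) (fun s t => hneg s t k) fun s => hnone s k
  refine ⟨⟨fun k => (LinearEquiv.ofBijective (ψ k) (hb k)).symm, fun k a => ?_⟩, fun k a => ?_⟩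
  · rw [LinearEquiv.symm_apply_eq]
    obtain ⟨a, rfl⟩ := (hb k.castSucc).2 a
    rw [show (LinearEquiv.ofBijective (ψ k.castSucc) (hb _)).symm (ψ k.castSucc a) = a from
      LinearEquiv.symm_apply_apply (LinearEquiv.ofBijective (ψ k.castSucc) (hb _)) a]
    rw [LinearEquiv.ofBijective_apply, hψ, hψ, map_sum]
    refine Finset.sum_congr rfl fun s _ => ?_
    rw [map_smul]
    change _ = χ s k.succ ((N s).map k (a s)) • _
    cases h : σ s with
    | none => simp
    | some t =>
      simp only [Option.elim_some]
      by_cases hk : (bar t).Has k.castSucc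
      · rw [hx.map_of_has t k hk]
        by_cases hk' : (bar t).Has k.succ
        · rw [hmap s t k _ h hk hk']
        · rw [hx.eq_zero t _ hk', smul_zero, smul_zero]
      · have := hneg s t _ h hk
        rw [Subsingleton.elim (a s) 0]
        simp
  · rw [← hψ]
    rfl

theorem nonempty_iso {ι : Type} [Fintype ι] {bar : ι → Bar ℓ} {x : ι → ∀ k, V.obj k}
    (hx : V.IsBarcodeFamily bar x) :
    Nonempty (V.Iso (directSum fun s => interval F (bar s))) := by
  obtain ⟨e, -⟩ := hx.exists_iso (fun s => interval F (bar s)) some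
    (fun t => ⟨t, rfl, fun s h => Option.some_injective _ h⟩)
    (fun s k => (intervalSpace F (bar s) k).subtype) (fun s k => Subtype.val_injective)
    (fun s t k h hk => by
      obtain rfl := Option.some_injective _ h
      exact surjective_subtype_intervalSpace hk)
    (fun s t k h hk => by
      obtain rfl := Option.some_injective _ h
      exact subsingleton_intervalSpace hk)
    (fun s k h => by simp at h)
    (fun s t k a h hk hk' => by
      obtain rfl := Option.some_injective _ h
      exact if_pos hk')
  exact ⟨e⟩

theorem triangular_zero {n : ℕ} {bar : Fin n → Bar ℓ} {x : Fin n → ∀ k, V.obj k}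
    (hx : V.IsBarcodeFamily bar x) (hbar : ∀ p q, p ≤ q → (bar p).hi ≤ (bar q).hi)
    {A : Fin n → Fin n → F} (hA : ∀ p q, p < q → A p q = 0) (p : Fin n) (k : Fin (ℓ + 1))
    (hk : (bar p).hi < k) : ∑ q, A p q • x q k = 0 := by
  refine Finset.sum_eq_zero fun q _ => ?_
  by_cases hq : p < q
  · rw [hA p q hq, zero_smul]
  · rw [hx.eq_zero q k fun h => absurd h.2 (not_le.2 ((hbar q p (not_lt.1 hq)).trans_lt hk)),
      smul_zero]

/-- Monotone left ends let the structure maps carry the combination along while `p` lives; monotone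
right ends make it vanish once `p` ends. At each `k` the submatrix of the bars present is still
triangular with nonzero diagonal, whence a basis. -/
theorem triangular {n : ℕ} {bar : Fin n → Bar ℓ} {x : Fin n → ∀ k, V.obj k}
    (hx : V.IsBarcodeFamily bar x)
    (hlo : ∀ p q, p ≤ q → (bar p).lo ≤ (bar q).lo) (hhi : ∀ p q, p ≤ q → (bar p).hi ≤ (bar q).hi)
    {A : Fin n → Fin n → F} (hA : ∀ p, A p p ≠ 0) (hA' : ∀ p q, p < q → A p q = 0) :
    V.IsBarcodeFamily bar fun p k => if (bar p).Has k then ∑ q, A p q • x q k else 0 := by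
  have key := fun k => linearIndependent_and_span_of_triangular (hx.basis k)
    (fun p q => A p q) (fun p => hA p) (fun p q h => hA' p q h)
  have hsum : ∀ k, (fun p : {p // (bar p).Has k} => if (bar p).Has k then ∑ q, A p q • x q k else 0)
      = fun p : {p // (bar p).Has k} => ∑ q : {p // (bar p).Has k}, A p q • hx.basis k q := fun k => by
    funext p
    rw [if_pos p.2]
    simp only [hx.basis_apply]
    exact (sum_subtype_smul (fun q => x q k) (fun q => (bar q).Has k) (A p)
      fun q h => by rw [hx.eq_zero q k h, smul_zero]).symm
  refine ⟨fun p k hk => if_neg hk, fun p k hk => ?_, fun k => ?_, fun k => ?_⟩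
  · rw [if_pos hk, map_sum]
    have h : ∑ q, V.map k (A p q • x q k.castSucc) = ∑ q, A p q • x q k.succ := by
      refine Finset.sum_congr rfl fun q _ => ?_
      by_cases hq : p < q
      · rw [hA' p q hq, zero_smul, zero_smul, map_zero]
      · rw [map_smul, hx.map_of_le q k ((hlo q p (not_lt.1 hq)).trans hk.1)]
    rw [h]
    split_ifs with hk'
    · rfl
    · exact hx.triangular_zero hhi hA' p _
        (not_le.1 fun h => hk' ⟨hk.1.trans Fin.castSucc_lt_succ.le, h⟩)
  · rw [hsum]
    exact (key k).1
  · rw [hsum]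
    exact (key k).2

end IsBarcodeFamily

end PersistenceModule

/-! ### Multiplicities and triangular elimination -/

/-- Classifying the elements of a finite type by `c` amounts to giving multiplicities. -/
theorem exists_equiv_sigma_fin {ι κ : Type} [Finite ι] (c : ι → κ) :
    ∃ (d : κ → ℕ) (e : ι ≃ Σ k, Fin (d k)), ∀ s, (e s).1 = c s := by
  refine ⟨fun k => Nat.card {s // c s = k}, (Equiv.sigmaFiberEquiv c).symm.trans
    (Equiv.sigmaCongrRight fun k => Finite.equivFin _), fun s => rfl⟩

theorem sum_option_elim {ι κ R : Type*} [Fintype ι] [Fintype κ] [AddCommMonoid R]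
    (μ : ι → Option κ) (hμ : ∀ p p' q, μ p = some q → μ p' = some q → p = p') (g : κ → R)
    [DecidablePred fun q => ∃ p, μ p = some q] :
    ∑ p, (μ p).elim 0 g = ∑ q, if ∃ p, μ p = some q then g q else 0 := by
  classical
  have h : ∀ p, (μ p).elim 0 g = ∑ q, if μ p = some q then g q else 0 := fun p => by
    cases μ p <;> simp
  simp_rw [h]
  rw [Finset.sum_comm]
  refine Finset.sum_congr rfl fun q _ => ?_
  split_ifs with hq
  · obtain ⟨p, hp⟩ := hq
    rw [Finset.sum_eq_single p, if_pos hp]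
    · intro p' _ hne
      exact if_neg fun h' => hne (hμ p' p q h' hp)
    · simp
  · exact Finset.sum_eq_zero fun p _ => if_neg fun h' => hq ⟨p, h'⟩

theorem exists_vecMul_eq_of_triangular {F : Type*} [Field F] {n : ℕ} (D : Fin n → Fin n → F)
    (hD : ∀ q, D q q ≠ 0) (hD' : ∀ q r, q < r → D q r = 0) (c : Fin n → F) :
    ∃ e : Fin n → F, ∀ q, c q = ∑ r, e r * D r q := by
  have hspan := (linearIndependent_and_span_of_triangular (Pi.basisFun F (Fin n)) D hD hD').2
  rw [← top_le_iff, Submodule.top_le_span_range_iff_forall_exists_fun] at hspan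
  obtain ⟨e, he⟩ := hspan c
  refine ⟨e, fun q => ?_⟩
  rw [← he, Finset.sum_apply]
  simp [Finset.sum_apply, Pi.single_apply]

/-- Every matrix is brought into the form of a partial matching by invertible lower triangular
row operations and a lower triangular change of the basis of the row space. -/
theorem exists_triangular_elimination {F : Type*} [Field F] {m n : ℕ} (c : Fin m → Fin n → F) :
    ∃ (A : Fin m → Fin m → F) (D : Fin n → Fin n → F) (μ : Fin m → Option (Fin n)),
      (∀ p, A p p ≠ 0) ∧ (∀ p p', p < p' → A p p' = 0) ∧
      (∀ q, D q q ≠ 0) ∧ (∀ q q', q < q' → D q q' = 0) ∧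
      (∀ p p' q, μ p = some q → μ p' = some q → p = p') ∧
      ∀ p q, ∑ p', A p p' * c p' q = (μ p).elim 0 fun r => D r q := by
  classical
  -- Induction on the number `t` of rows already treated; rows from `t` on are kept unmatched.
  suffices h : ∀ t ≤ m, ∃ (A : Fin m → Fin m → F) (D : Fin n → Fin n → F)
      (μ : Fin m → Option (Fin n)),
      (∀ p, A p p ≠ 0) ∧ (∀ p p', p < p' → A p p' = 0) ∧
      (∀ q, D q q ≠ 0) ∧ (∀ q q', q < q' → D q q' = 0) ∧
      (∀ p p' q, μ p = some q → μ p' = some q → p = p') ∧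
      (∀ p : Fin m, t ≤ p → μ p = none) ∧
      ∀ p : Fin m, p < t → ∀ q, ∑ p', A p p' * c p' q = (μ p).elim 0 fun r => D r q by
    obtain ⟨A, D, μ, h1, h2, h3, h4, h5, -, h7⟩ := h m le_rfl
    exact ⟨A, D, μ, h1, h2, h3, h4, h5, fun p => h7 p p.2⟩
  intro t
  induction t with
  | zero =>
    intro _
    refine ⟨(1 : Matrix _ _ F), (1 : Matrix _ _ F), fun _ => none,
      fun p => ?_, fun p p' h => ?_, fun p => ?_, fun p p' h => ?_,
      ?_, fun _ _ => rfl, fun p hp => absurd hp (Nat.not_lt_zero _)⟩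
    · exact (Matrix.one_apply_eq (α := F) p).trans_ne one_ne_zero
    · exact Matrix.one_apply_ne (α := F) h.ne
    · exact (Matrix.one_apply_eq (α := F) p).trans_ne one_ne_zero
    · exact Matrix.one_apply_ne (α := F) h.ne
    · simp
  | succ t ih =>
    intro ht
    obtain ⟨A, D, μ, hA, hA', hD, hD', hμ, hnone, heq⟩ := ih (by omega)
    let τ : Fin m := ⟨t, ht⟩
    have hτ : ∀ p : Fin m, p ≠ τ → t ≤ (p : ℕ) → t + 1 ≤ (p : ℕ) := fun p hp h =>
      Nat.lt_of_le_of_ne h fun h' => hp (Fin.ext h'.symm)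
    have hτ' : ∀ p : Fin m, p ≠ τ → (p : ℕ) < t + 1 → (p : ℕ) < t := fun p hp h =>
      Nat.lt_of_le_of_ne (Nat.le_of_lt_succ h) fun h' => hp (Fin.ext h')
    obtain ⟨e, he⟩ := exists_vecMul_eq_of_triangular D hD hD' (c τ)
    -- The new row `τ` of `A` subtracts earlier rows so as to cancel, in the expansion of `c τ` in
    -- the rows of `D`, those rows already matched; `e'` below is what remains.
    let a : Fin m → F := fun p' => (if p' = τ then 1 else 0) - ∑ p, (μ p).elim 0 e * A p p'
    have ha : ∀ p', τ ≤ p' → a p' = if p' = τ then 1 else 0 := fun p' hp' => by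
      rw [sub_eq_self]
      refine Finset.sum_eq_zero fun p _ => ?_
      by_cases hp : p < τ
      · rw [hA' p p' (hp.trans_le hp'), mul_zero]
      · rw [hnone p (not_lt.1 hp), Option.elim_none, zero_mul]
    let e' : Fin n → F := fun r => if ∃ p, μ p = some r then 0 else e r
    have hsum : ∀ q, ∑ p', a p' * c p' q = ∑ r, e' r * D r q := fun q => by
      have h1 : ∀ p, ∑ p', (μ p).elim 0 e * A p p' * c p' q
          = (μ p).elim 0 fun r => e r * D r q := fun p => by
        simp_rw [mul_assoc]
        rw [← Finset.mul_sum]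
        by_cases hp : (p : ℕ) < t
        · rw [heq p hp]
          cases μ p <;> simp
        · rw [hnone p (not_lt.1 hp), Option.elim_none, zero_mul, Option.elim_none]
      simp only [a, sub_mul, Finset.sum_sub_distrib, Finset.sum_mul]
      rw [Finset.sum_comm (s := Finset.univ) (t := Finset.univ)
        (f := fun p' p => (μ p).elim 0 e * A p p' * c p' q)]
      simp only [h1]
      rw [sum_option_elim μ hμ]
      simp only [ite_mul, one_mul, zero_mul, Finset.sum_ite_eq', Finset.mem_univ, if_true]
      rw [he q, ← Finset.sum_sub_distrib]
      refine Finset.sum_congr rfl fun r _ => ?_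
      simp only [e']
      split_ifs <;> simp
    have hB : ∀ p, Function.update A τ a p p ≠ 0 := fun p => by
      by_cases hp : p = τ
      · subst hp
        rw [Function.update_self, ha _ le_rfl, if_pos rfl]
        exact one_ne_zero
      · rw [Function.update_of_ne hp]
        exact hA p
    have hB' : ∀ p p', p < p' → Function.update A τ a p p' = 0 := fun p p' h => by
      by_cases hp : p = τ
      · subst hp
        rw [Function.update_self, ha _ h.le, if_neg h.ne']
      · rw [Function.update_of_ne hp]
        exact hA' p p' h
    by_cases hz : ∀ r, e' r = 0
    · refine ⟨Function.update A τ a, D, μ, hB, hB', hD, hD', hμ,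
        fun p hp => hnone p (by omega), fun p hp q => ?_⟩
      by_cases h : p = τ
      · subst h
        simp only [Function.update_self]
        rw [hsum, hnone _ le_rfl]
        simp [hz]
      · rw [Function.update_of_ne h]
        exact heq p (hτ' p h hp) q
    · obtain ⟨r₀, hr₀⟩ := not_forall.1 hz
      let S : Finset (Fin n) := Finset.univ.filter fun r => e' r ≠ 0
      have hS : S.Nonempty := ⟨r₀, by simp [S, hr₀]⟩
      -- The remainder ends in column `q₀`, with entry e'(q₀)·D(q₀,q₀) ≠ 0. It can therefore replace
      -- row `q₀` of `D`, which is still unmatched, without spoiling triangularity or the earlier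
      -- equations.
      let q₀ := S.max' hS
      have hq₀ : e' q₀ ≠ 0 := (Finset.mem_filter.1 (S.max'_mem hS)).2
      have hmax : ∀ r, q₀ < r → e' r = 0 := fun r hr => by
        by_contra h
        exact absurd (S.le_max' r (by simp [S, h])) (not_le.2 hr)
      have hun : ∀ p, μ p ≠ some q₀ := fun p hp => hq₀ (if_pos ⟨p, hp⟩)
      have hz : ∀ q, q₀ ≤ q → ∑ r, e' r * D r q = e' q₀ * D q₀ q := fun q hq => by
        refine Finset.sum_eq_single q₀ (fun r _ hr => ?_) (by simp)
        rcases lt_or_gt_of_ne hr with h | h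
        · rw [hD' r q (h.trans_le hq), mul_zero]
        · rw [hmax r h, zero_mul]
      refine ⟨Function.update A τ a, Function.update D q₀ fun q => ∑ r, e' r * D r q,
        Function.update μ τ (some q₀), hB, hB', fun q => ?_, fun q q' h => ?_,
        fun p p' q hp hp' => ?_, fun p hp => ?_, fun p hp q => ?_⟩
      · by_cases hq : q = q₀
        · subst hq
          rw [Function.update_self, hz _ le_rfl]
          exact mul_ne_zero hq₀ (hD _)
        · rw [Function.update_of_ne hq]
          exact hD q
      · by_cases hq : q = q₀
        · subst hq
          rw [Function.update_self, hz _ h.le, hD' _ _ h, mul_zero]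
        · rw [Function.update_of_ne hq]
          exact hD' q q' h
      · by_cases h : p = τ <;> by_cases h' : p' = τ
        · rw [h, h']
        · subst h
          rw [Function.update_self] at hp
          rw [Function.update_of_ne h', ← hp] at hp'
          exact absurd hp' (hun _)
        · subst h'
          rw [Function.update_self] at hp'
          rw [Function.update_of_ne h, ← hp'] at hp
          exact absurd hp (hun _)
        · rw [Function.update_of_ne h] at hp
          rw [Function.update_of_ne h'] at hp'
          exact hμ p p' q hp hp'
      · have h : p ≠ τ := fun h => by
          subst h
          exact absurd hp (Nat.not_succ_le_self t)
        rw [Function.update_of_ne h]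
        exact hnone p (by omega)
      · by_cases h : p = τ
        · subst h
          simp only [Function.update_self, Option.elim_some]
          exact hsum q
        · rw [Function.update_of_ne h, Function.update_of_ne h, heq p (hτ' p h hp) q]
          cases hp : μ p with
          | none => rfl
          | some r =>
            simp only [Option.elim_some]
            rw [Function.update_of_ne fun h' => hun p (hp.trans (congrArg some h'))]

/-! ### Monotone barcodes and the matching -/

namespace PersistenceModule

variable {F : Type u} [Field F] {ℓ : ℕ}

/-- If no two bars of `V` are strictly nested, then `V` has a barcode family whose left and right
endpoints are both monotone. -/
theorem NoStrictlyNestedBars.exists_monotone_family {V : PersistenceModule.{u, v} F ℓ}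
    (hV : V.NoStrictlyNestedBars) :
    ∃ (n : ℕ) (bar : Fin n → Bar ℓ) (x : Fin n → ∀ k, V.obj k), V.IsBarcodeFamily bar x ∧
      (∀ p q, p ≤ q → (bar p).LexLE (bar q)) ∧ (∀ p q, p ≤ q → (bar p).lo ≤ (bar q).lo) ∧
      ∀ p q, p ≤ q → (bar p).hi ≤ (bar q).hi := by
  obtain ⟨ι, _, bar, x, hx⟩ := V.exists_isBarcodeFamily
  obtain ⟨e, he⟩ := Bar.exists_sort bar
  obtain ⟨d, e', he'⟩ := exists_equiv_sigma_fin bar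
  have hbar : ∀ s, bar (e'.symm s) = s.1 := fun s => by rw [← he', Equiv.apply_symm_apply]
  have hd : V.HasBarcode d := by
    have h := (hx.comp_equiv e'.symm).nonempty_iso
    simp only [hbar] at h
    exact h
  have hpos : ∀ s, 0 < d (bar s) := fun s => by
    rw [← he' s]
    exact Fin.pos (e' s).2
  refine ⟨_, _, _, hx.comp_equiv e, he, fun p q h => ?_, fun p q h => ?_⟩
  · rcases he p q h with h' | h'
    · exact h'.le
    · exact h'.1.le
  · rcases he p q h with h' | h'
    -- A bar that begins strictly later and ends strictly earlier would be strictly nested.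
    · exact not_lt.1 fun h'' => hV d hd _ _ (hpos (e p)) (hpos (e q)) ⟨h', h''⟩
    · exact h'.2

end PersistenceModule

namespace LadderModule

open PersistenceModule

variable {F : Type u} [Field F] {ℓ : ℕ} (L : LadderModule.{u, v, w} F ℓ)

/-- The coefficients are read off where `p` begins, and naturality carries them to all later
positions, even beyond the end of `p`. -/
theorem exists_hom_coeff {κ κ' : Type} [Fintype κ'] {bar : κ → Bar ℓ} {x : κ → ∀ k, L.src.obj k}
    (hx : L.src.IsBarcodeFamily bar x) {bar' : κ' → Bar ℓ} {y : κ' → ∀ k, L.tgt.obj k}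
    (hy : L.tgt.IsBarcodeFamily bar' y) :
    ∃ c : κ → κ' → F,
      (∀ p q, c p q ≠ 0 → (bar' q).lo ≤ (bar p).lo ∧ (bar' q).hi ≤ (bar p).hi) ∧
      ∀ p k, (bar p).lo ≤ k → L.hom k (x p k) = ∑ q, c p q • y q k := by
  have hspan : ∀ p, ∃ e : κ' → F, ∑ q, e q • y q (bar p).lo = L.hom _ (x p (bar p).lo) :=
    fun p => (span_subtype_eq_top_iff (fun q => y q (bar p).lo) _
      fun q h => hy.eq_zero q _ h).1 (hy.span_eq_top _) _
  choose e he using hspan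
  -- Coefficients of bars absent at the left end of `p` are arbitrary there; they must be cleared
  -- lest bars beginning later contribute.
  let c : κ → κ' → F := fun p q => if (bar' q).Has (bar p).lo then e p q else 0
  have hc : ∀ p q, c p q ≠ 0 → (bar' q).Has (bar p).lo := fun p q h => by
    by_contra h'
    exact h (if_neg h')
  have hhom : ∀ p k, (bar p).lo ≤ k → L.hom k (x p k) = ∑ q, c p q • y q k := by
    intro p k
    have hbase : ∀ k, (bar p).lo = k → L.hom k (x p k) = ∑ q, c p q • y q k := by
      rintro _ rfl
      rw [← he]
      refine Finset.sum_congr rfl fun q _ => ?_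
      by_cases h : (bar' q).Has (bar p).lo
      · simp only [c, if_pos h]
      · rw [hy.eq_zero q _ h, smul_zero, smul_zero]
    induction k using Fin.induction with
    | zero => exact fun h => hbase 0 (le_antisymm h (Fin.zero_le _))
    | succ k ih =>
      intro h
      rcases h.eq_or_lt with h | h
      · exact hbase _ h
      · have h' : (bar p).lo ≤ k.castSucc := Fin.le_castSucc_iff.2 h
        rw [← hx.map_of_le p k h', L.comm, ih h', map_sum]
        refine Finset.sum_congr rfl fun q _ => ?_
        by_cases hcq : c p q = 0
        · rw [hcq, zero_smul, zero_smul, map_zero]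
        · rw [map_smul, hy.map_of_le q k ((hc p q hcq).1.trans h')]
  refine ⟨c, fun p q hcq => ⟨(hc p q hcq).1, not_lt.1 fun hlt => hcq ?_⟩, hhom⟩
  -- If `q` outlived `p`, then just after the end of `p` the image is zero while `y q` is still a
  -- basis vector, so the coefficient vanishes.
  obtain ⟨k, hk⟩ := Fin.exists_castSucc_eq.2 (hlt.trans_le (Fin.le_last _)).ne
  have hk' : (bar p).hi < k.succ := hk ▸ Fin.castSucc_lt_succ
  have hsum := hhom p k.succ ((bar p).2.trans hk'.le)
  rw [hx.eq_zero p k.succ fun h => absurd h.2 (not_le.2 hk'), map_zero] at hsum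
  have key := (linearIndependent_subtype_iff_forall (fun q => y q k.succ) _).1
    (hy.linearIndependent k.succ) (fun q => if (bar' q).Has k.succ then c p q else 0)
    (fun q h => if_neg h) (by
      rw [hsum]
      refine Finset.sum_congr rfl fun q _ => ?_
      by_cases h : (bar' q).Has k.succ
      · rw [if_pos h]
      · rw [hy.eq_zero q _ h, smul_zero, smul_zero]) q
  have hq : (bar' q).Has k.succ := by
    refine ⟨(hc p q hcq).1.trans ((bar p).2.trans hk'.le), ?_⟩
    rw [← hk] at hlt
    exact Fin.castSucc_lt_iff_succ_le.1 hlt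
  rwa [if_pos hq] at key

theorem exists_matching {n n' : ℕ} {bar : Fin n → Bar ℓ} {x : Fin n → ∀ k, L.src.obj k}
    (hx : L.src.IsBarcodeFamily bar x) (hlo : ∀ p q, p ≤ q → (bar p).lo ≤ (bar q).lo)
    (hhi : ∀ p q, p ≤ q → (bar p).hi ≤ (bar q).hi)
    {bar' : Fin n' → Bar ℓ} {y : Fin n' → ∀ k, L.tgt.obj k}
    (hy : L.tgt.IsBarcodeFamily bar' y) (hlo' : ∀ p q, p ≤ q → (bar' p).lo ≤ (bar' q).lo)
    (hhi' : ∀ p q, p ≤ q → (bar' p).hi ≤ (bar' q).hi) :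
    ∃ (x' : Fin n → ∀ k, L.src.obj k) (y' : Fin n' → ∀ k, L.tgt.obj k) (μ : Fin n → Option (Fin n')),
      L.src.IsBarcodeFamily bar x' ∧ L.tgt.IsBarcodeFamily bar' y' ∧
      (∀ p p' q, μ p = some q → μ p' = some q → p = p') ∧
      (∀ p q, μ p = some q → (bar' q).Prec (bar p)) ∧
      ∀ p k, (bar p).Has k → L.hom k (x' p k) = (μ p).elim 0 fun q => y' q k := by
  classical
  obtain ⟨c, hc, hhom⟩ := L.exists_hom_coeff hx hy
  obtain ⟨A, D, μ, hA, hA', hD, hD', hμ, heq⟩ := exists_triangular_elimination c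
  -- The entry of the reduced matrix at a matched pair is `D q q`, so some row p' ≤ p of `c` has a
  -- nonzero entry in column `q`; monotone endpoints pass from `p'` to `p`.
  have hle : ∀ p q, μ p = some q → (bar' q).lo ≤ (bar p).lo ∧ (bar' q).hi ≤ (bar p).hi := by
    intro p q h
    have hne : ∑ p', A p p' * c p' q ≠ 0 := by
      rw [heq, h]
      exact hD q
    obtain ⟨p', -, hp'⟩ := Finset.exists_ne_zero_of_sum_ne_zero hne
    have hpp' : p' ≤ p := not_lt.1 fun h => left_ne_zero_of_mul hp' (hA' p p' h)
    obtain ⟨h1, h2⟩ := hc p' q (right_ne_zero_of_mul hp')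
    exact ⟨h1.trans (hlo _ _ hpp'), h2.trans (hhi _ _ hpp')⟩
  -- Row operations may match `p` to a bar that ends before `p` begins; its new generator vanishes
  -- throughout `p`, so the pair is dropped.
  let μ' : Fin n → Option (Fin n') := fun p => (μ p).filter fun q => (bar p).lo ≤ (bar' q).hi
  have hμ' : ∀ p q, μ' p = some q ↔ μ p = some q ∧ (bar p).lo ≤ (bar' q).hi := fun p q => by
    simp [μ', Option.filter_eq_some_iff]
  refine ⟨_, _, μ', hx.triangular hlo hhi hA hA', hy.triangular hlo' hhi' hD hD',
    fun p p' q h h' => hμ p p' q ((hμ' p q).1 h).1 ((hμ' p' q).1 h').1, fun p q h => ?_,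
    fun p k hk => ?_⟩
  · obtain ⟨h1, h2⟩ := (hμ' p q).1 h
    exact ⟨(hle p q h1).1, h2, (hle p q h1).2⟩
  · have h1 : L.hom k (∑ p', A p p' • x p' k) = ∑ q, ((μ p).elim 0 fun r => D r q) • y q k := by
      simp_rw [← heq p, Finset.sum_smul, map_sum]
      rw [Finset.sum_comm]
      refine Finset.sum_congr rfl fun p' _ => ?_
      by_cases hp' : p < p'
      · simp [hA' p p' hp']
      · rw [map_smul, hhom p' k ((hlo _ _ (not_lt.1 hp')).trans hk.1), Finset.smul_sum]
        simp only [mul_smul]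
    rw [if_pos hk, h1]
    cases h : μ p with
    | none => simp [μ', h]
    | some q =>
      by_cases hpq : (bar p).lo ≤ (bar' q).hi
      · rw [(hμ' p q).2 ⟨h, hpq⟩]
        simp only [Option.elim_some]
        split_ifs with hk'
        · rfl
        · exact hy.triangular_zero hhi' hD' q k
            (not_le.1 fun h' => hk' ⟨(hle p q h).1.trans hk.1, h'⟩)
      · have hnone : μ' p = none := by
          cases h' : μ' p with
          | none => rfl
          | some r =>
            obtain ⟨h1, h2⟩ := (hμ' p r).1 h'
            obtain rfl := Option.some_injective _ (h.symm.trans h1)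
            exact absurd h2 hpq
        rw [hnone]
        exact hy.triangular_zero hhi' hD' q k ((not_le.1 hpq).trans_le hk.1)

end LadderModule

/-! ### From the matching to the direct sum -/

/-- The partial equivalence given by an injective partial function. -/
theorem exists_pEquiv {α β : Type*} (μ : α → Option β)
    (hμ : ∀ p p' q, μ p = some q → μ p' = some q → p = p') : ∃ m : α ≃. β, ∀ p, m p = μ p := by
  classical
  refine ⟨⟨μ, fun q => if h : ∃ p, μ p = some q then some h.choose else none, fun p q => ?_⟩,
    fun p => rfl⟩
  constructor
  · intro h
    by_cases h' : ∃ p, μ p = some q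
    · rw [dif_pos h'] at h
      exact Option.some_injective _ h ▸ h'.choose_spec
    · rw [dif_neg h'] at h
      simp at h
  · intro h
    have h' : ∃ p, μ p = some q := ⟨p, h⟩
    rw [dif_pos h']
    exact congrArg some (hμ _ _ q h'.choose_spec h)

namespace LadderModule

open PersistenceModule

variable {F : Type u} [Field F] {ℓ : ℕ}

theorem nonempty_iso_directSum_of_matching (L : LadderModule.{u, v, w} F ℓ) {n n' : ℕ}
    {bar : Fin n → Bar ℓ} {x : Fin n → ∀ k, L.src.obj k} (hx : L.src.IsBarcodeFamily bar x)
    {bar' : Fin n' → Bar ℓ} {y : Fin n' → ∀ k, L.tgt.obj k} (hy : L.tgt.IsBarcodeFamily bar' y)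
    {μ : Fin n → Option (Fin n')} (hμ : ∀ p p' q, μ p = some q → μ p' = some q → p = p')
    (hprec : ∀ p q, μ p = some q → (bar' q).Prec (bar p))
    (hhom : ∀ p k, (bar p).Has k → L.hom k (x p k) = (μ p).elim 0 fun q => y q k) :
    Nonempty (L.Iso (directSum (ι := {s : Fin n × Fin n' // μ s.1 = some s.2} ⊕
        ({p // μ p = none} ⊕ {q // ∀ p, μ p ≠ some q})) <|
      Sum.elim (fun s => R F (bar' s.1.2) (bar s.1.1) (hprec _ _ s.2)) <|
        Sum.elim (fun s => IPlus F (bar s.1)) fun s => IMinus F (bar' s.1))) := by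
  classical
  set M : {s : Fin n × Fin n' // μ s.1 = some s.2} ⊕
      ({p // μ p = none} ⊕ {q // ∀ p, μ p ≠ some q}) → LadderModule.{u, u, u} F ℓ :=
    Sum.elim (fun s => R F (bar' s.1.2) (bar s.1.1) (hprec _ _ s.2)) <|
        Sum.elim (fun s => IPlus F (bar s.1)) fun s => IMinus F (bar' s.1)
  let χ : ∀ s k, (M s).src.obj k →ₗ[F] F := fun s k => match s with
    | .inl s => (intervalSpace F (bar s.1.1) k).subtype
    | .inr (.inl s) => (intervalSpace F (bar s.1) k).subtype
    | .inr (.inr _) => 0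
  let χ' : ∀ s k, (M s).tgt.obj k →ₗ[F] F := fun s k => match s with
    | .inl s => (intervalSpace F (bar' s.1.2) k).subtype
    | .inr (.inl _) => 0
    | .inr (.inr s) => (intervalSpace F (bar' s.1) k).subtype
  obtain ⟨e, he⟩ := hx.exists_iso (fun s => (M s).src)
    (Sum.elim (fun s => some s.1.1) (Sum.elim (fun s => some s.1) fun _ => none))
    (by
      intro p
      cases h : μ p with
      | none =>
        refine ⟨.inr (.inl ⟨p, h⟩), rfl, ?_⟩
        rintro (⟨⟨p', q⟩, hs⟩ | ⟨p', hs⟩ | s) h'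
        · obtain rfl := Option.some_injective _ h'
          simp [h] at hs
        · obtain rfl := Option.some_injective _ h'
          rfl
        · simp at h'
      | some q =>
        refine ⟨.inl ⟨(p, q), h⟩, rfl, ?_⟩
        rintro (⟨⟨p', q'⟩, hs⟩ | ⟨p', hs⟩ | s) h'
        · obtain rfl := Option.some_injective _ h'
          obtain rfl := Option.some_injective _ (h.symm.trans hs)
          rfl
        · obtain rfl := Option.some_injective _ h'
          simp [h] at hs
        · simp at h') χ
    (by
      rintro (s | s | s) k
      · exact Subtype.val_injective
      · exact Subtype.val_injective
      · exact fun _ _ _ => rfl)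
    (by
      rintro (s | s | s) t k h hk
      · obtain rfl := Option.some_injective _ h
        exact surjective_subtype_intervalSpace hk
      · obtain rfl := Option.some_injective _ h
        exact surjective_subtype_intervalSpace hk
      · simp at h)
    (by
      rintro (s | s | s) t k h hk
      · obtain rfl := Option.some_injective _ h
        exact subsingleton_intervalSpace hk
      · obtain rfl := Option.some_injective _ h
        exact subsingleton_intervalSpace hk
      · simp at h)
    (by
      rintro (s | s | s) k h
      · simp at h
      · simp at h
      · exact inferInstanceAs (Subsingleton PUnit))
    (by
      rintro (s | s | s) t k a h hk hk'
      · obtain rfl := Option.some_injective _ h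
        exact if_pos hk'
      · obtain rfl := Option.some_injective _ h
        exact if_pos hk'
      · simp at h)
  obtain ⟨e', he'⟩ := hy.exists_iso (fun s => (M s).tgt)
    (Sum.elim (fun s => some s.1.2) (Sum.elim (fun _ => none) fun s => some s.1))
    (by
      intro q
      by_cases h : ∃ p, μ p = some q
      · obtain ⟨p, hp⟩ := h
        refine ⟨.inl ⟨(p, q), hp⟩, rfl, ?_⟩
        rintro (⟨⟨p', q'⟩, hs⟩ | s | ⟨q', hs⟩) h'
        · obtain rfl := Option.some_injective _ h'
          obtain rfl := hμ p p' _ hp hs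
          rfl
        · simp at h'
        · obtain rfl := Option.some_injective _ h'
          exact absurd hp (hs p)
      · refine ⟨.inr (.inr ⟨q, not_exists.1 h⟩), rfl, ?_⟩
        rintro (⟨⟨p', q'⟩, hs⟩ | s | ⟨q', hs⟩) h'
        · obtain rfl := Option.some_injective _ h'
          exact absurd ⟨p', hs⟩ h
        · simp at h'
        · obtain rfl := Option.some_injective _ h'
          rfl) χ'
    (by
      rintro (s | s | s) k
      · exact Subtype.val_injective
      · exact fun _ _ _ => rfl
      · exact Subtype.val_injective)
    (by
      rintro (s | s | s) t k h hk
      · obtain rfl := Option.some_injective _ h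
        exact surjective_subtype_intervalSpace hk
      · simp at h
      · obtain rfl := Option.some_injective _ h
        exact surjective_subtype_intervalSpace hk)
    (by
      rintro (s | s | s) t k h hk
      · obtain rfl := Option.some_injective _ h
        exact subsingleton_intervalSpace hk
      · simp at h
      · obtain rfl := Option.some_injective _ h
        exact subsingleton_intervalSpace hk)
    (by
      rintro (s | s | s) k h
      · simp at h
      · exact inferInstanceAs (Subsingleton PUnit)
      · simp at h)
    (by
      rintro (s | s | s) t k a h hk hk'
      · obtain rfl := Option.some_injective _ h
        exact if_pos hk'
      · simp at h
      · obtain rfl := Option.some_injective _ h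
        exact if_pos hk')
  refine ⟨⟨e, e', fun k a => ?_⟩⟩
  -- Compatibility is tested on the direct sum, where the inverse isomorphisms are explicit.
  obtain ⟨b, rfl⟩ := (e.equiv k).symm.surjective a
  rw [LinearEquiv.apply_symm_apply, ← LinearEquiv.eq_symm_apply, he, he', map_sum]
  refine Finset.sum_congr rfl fun s _ => ?_
  rw [map_smul]
  change _ = χ' s k ((M s).hom k (b s)) • _
  -- Off the bar of `p` the hypothesis `hhom` says nothing, but there the coordinate itself is zero.
  have hzero : ∀ (I : Bar ℓ) (c : intervalSpace F I k), ¬ I.Has k → (c : F) = 0 := fun I c hI => by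
    have := subsingleton_intervalSpace (F := F) hI
    rw [Subsingleton.elim c 0, Submodule.coe_zero]
  rcases s with s | s | s
  · have h : ∀ (p q) (c : intervalSpace F (bar p) k), μ p = some q →
        c.1 • L.hom k (x p k) = (if (bar' q).Has k then c.1 else 0) • y q k := by
      intro p q c hpq
      by_cases hk : (bar p).Has k
      · rw [hhom _ _ hk, hpq, Option.elim_some]
        split_ifs with hk'
        · rfl
        · rw [hy.eq_zero _ _ hk', smul_zero, smul_zero]
      · rw [hzero _ _ hk, ite_self, zero_smul, zero_smul]
    exact h _ _ _ s.2
  · have h : ∀ (p) (c : intervalSpace F (bar p) k), μ p = none →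
        c.1 • L.hom k (x p k) = (0 : F) • (0 : L.tgt.obj k) := by
      intro p c hp
      by_cases hk : (bar p).Has k
      · rw [hhom _ _ hk, hp, Option.elim_none, smul_zero, smul_zero]
      · rw [hzero _ _ hk, zero_smul, smul_zero]
    exact h _ _ s.2
  · change (0 : F) • L.hom k 0 = (0 : F) • y s.1 k
    rw [zero_smul, zero_smul]

theorem nonempty_iso_directSum_comp {ι κ : Type} [Finite ι] [Finite κ]
    (M : κ → LadderModule.{u, v, w} F ℓ) (e : ι ≃ κ) :
    Nonempty ((directSum fun s => M (e s)).Iso (directSum M)) := by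
  refine ⟨⟨⟨fun k => LinearEquiv.piCongrLeft F (fun t => (M t).src.obj k) e, fun k a => ?_⟩,
    ⟨fun k => LinearEquiv.piCongrLeft F (fun t => (M t).tgt.obj k) e, fun k a => ?_⟩,
    fun k a => ?_⟩⟩
  · funext t
    obtain ⟨s, rfl⟩ := e.surjective t
    refine (Equiv.piCongrLeft_apply_apply (fun t => (M t).src.obj k.succ) e _ s).trans ?_
    exact congrArg ((M (e s)).src.map k)
      (Equiv.piCongrLeft_apply_apply (fun t => (M t).src.obj k.castSucc) e a s).symm
  · funext t
    obtain ⟨s, rfl⟩ := e.surjective t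
    refine (Equiv.piCongrLeft_apply_apply (fun t => (M t).tgt.obj k.succ) e _ s).trans ?_
    exact congrArg ((M (e s)).tgt.map k)
      (Equiv.piCongrLeft_apply_apply (fun t => (M t).tgt.obj k.castSucc) e a s).symm
  · funext t
    obtain ⟨s, rfl⟩ := e.surjective t
    refine (Equiv.piCongrLeft_apply_apply (fun t => (M t).tgt.obj k) e _ s).trans ?_
    exact congrArg ((M (e s)).hom k)
      (Equiv.piCongrLeft_apply_apply (fun t => (M t).src.obj k) e a s).symm

/-- The composition of isomorphisms of ladder modules. -/
def Iso.trans {L : LadderModule.{u, v, w} F ℓ} {M N : LadderModule.{u, x, y} F ℓ} (e : L.Iso M)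
    (e' : M.Iso N) : L.Iso N where
  src := ⟨fun k => (e.src.equiv k).trans (e'.src.equiv k), fun k a => by
    simp only [LinearEquiv.trans_apply, e.src.comm, e'.src.comm]⟩
  tgt := ⟨fun k => (e.tgt.equiv k).trans (e'.tgt.equiv k), fun k a => by
    simp only [LinearEquiv.trans_apply, e.tgt.comm, e'.tgt.comm]⟩
  comm k a := by simp only [LinearEquiv.trans_apply, e.comm, e'.comm]

theorem nonempty_iso_standardSum (L : LadderModule.{u, v, w} F ℓ) {α β γ : Type} [Finite α]
    [Finite β] [Finite γ] (a : α → PrecPair ℓ) (b : β → Bar ℓ) (c : γ → Bar ℓ)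
    (h : Nonempty (L.Iso (directSum (ι := α ⊕ (β ⊕ γ)) <|
      Sum.elim (fun s => R F (a s).1.1 (a s).1.2 (a s).2) <|
        Sum.elim (fun s => IPlus F (b s)) fun s => IMinus F (c s)))) :
    ∃ (r : PrecPair ℓ → ℕ) (dp dm : Bar ℓ → ℕ), Nonempty (L.Iso (standardSum F r dp dm)) := by
  obtain ⟨r, ea, ha⟩ := exists_equiv_sigma_fin a
  obtain ⟨dp, eb, hb⟩ := exists_equiv_sigma_fin b
  obtain ⟨dm, ec, hc⟩ := exists_equiv_sigma_fin c
  obtain rfl : (fun s => (ea s).1) = a := funext ha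
  obtain rfl : (fun s => (eb s).1) = b := funext hb
  obtain rfl : (fun s => (ec s).1) = c := funext hc
  obtain ⟨e⟩ := h
  refine ⟨r, dp, dm, ?_⟩
  obtain ⟨e'⟩ := nonempty_iso_directSum_comp
    (Sum.elim (fun s => R F s.1.1.1 s.1.1.2 s.1.2) <|
      Sum.elim (fun s => IPlus F s.1) (fun s => IMinus F s.1) :
      ((Σ p : PrecPair ℓ, Fin (r p)) ⊕ (Σ I : Bar ℓ, Fin (dp I)) ⊕ (Σ I : Bar ℓ, Fin (dm I))) →
        LadderModule.{u, u, u} F ℓ) (Equiv.sumCongr ea (Equiv.sumCongr eb ec))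
  refine ⟨e.trans (N := standardSum F r dp dm) ?_⟩
  convert e' using 2
  · funext s
    rcases s with s | s | s <;> rfl
  · rfl

end LadderModule

theorem theorem4p3 {F : Type u} [Field F] {ℓ : ℕ} (L : LadderModule.{u, v, w} F ℓ)
    (hV : L.src.NoStrictlyNestedBars) (hW : L.tgt.NoStrictlyNestedBars) :
    (∃ (r : LadderModule.PrecPair ℓ → ℕ) (dp dm : Bar ℓ → ℕ),
      Nonempty (L.Iso (LadderModule.standardSum F r dp dm))) ∧
    (∃ (B : L.src.BarcodeBasis) (C : L.tgt.BarcodeBasis) (m : Fin B.card ≃. Fin C.card),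
      L.IsMatchedBy B C m) := by
  obtain ⟨n, bar, x, hx, hlex, hlo, hhi⟩ := hV.exists_monotone_family
  obtain ⟨n', bar', y, hy, hlex', hlo', hhi'⟩ := hW.exists_monotone_family
  obtain ⟨x', y', μ, hx', hy', hμ, hprec, hhom⟩ :=
    L.exists_matching hx hlo hhi hy hlo' hhi'
  refine ⟨L.nonempty_iso_standardSum
    (fun s : {s : Fin n × Fin n' // μ s.1 = some s.2} =>
      ⟨(bar' s.1.2, bar s.1.1), hprec _ _ s.2⟩) _ _
    (L.nonempty_iso_directSum_of_matching hx' hy' hμ hprec hhom), ?_⟩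
  obtain ⟨m, hm⟩ := exists_pEquiv μ hμ
  have hsome : ∀ p q k, (bar p).Has k → μ p = some q → L.hom k (x' p k) = y' q k :=
    fun p q k hk h => by rw [hhom p k hk, h, Option.elim_some]
  have hnone : ∀ p k, (bar p).Has k → μ p = none → L.hom k (x' p k) = 0 :=
    fun p k hk h => by rw [hhom p k hk, h, Option.elim_none]
  refine ⟨hx'.barcodeBasis hlex, hy'.barcodeBasis hlex', m, fun p q h => ?_, fun k p q h => ?_,
    fun k p h => ?_⟩
  · exact hprec p q ((hm p).symm.trans h)
  · refine (congrArg (L.hom k) (hx'.basis_apply k p)).trans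
      ((hsome p.1 q k p.2 ((hm p.1).symm.trans h)).trans ?_)
    split_ifs with hk
    · exact (hy'.basis_apply k ⟨q, hk⟩).symm
    · exact hy'.eq_zero q k hk
  · exact (congrArg (L.hom k) (hx'.basis_apply k p)).trans
      (hnone p.1 k p.2 ((hm p.1).symm.trans h))
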